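/- Let $M\ge 7$ be an integer with $M\equiv 2$ or $3 \pmod 5$, and put $[M]_q=1+q+\cdots+q^{M-1}$. Then, as formal power series in $q$ with coefficients in $\mathbb{Z}[t,w]$ (the infinite sum and product converging coefficientwise), $$ \begin{aligned} 1&+\frac{q^2(t+q)}{1-tq^{2}}+\frac{q^6\left([M]_q+(w-1)(q^{M-3}+q^{M-6})\right)}{(1-tq^2)(1-wq^M)} +\sum_{k=3}^{M-1}\frac{q^{k(k+1)}\,[M]_q}{(1-tq^2)(1-q^3)(1-q^4)\cdots(1-q^{k})(1-wq^M)}\\ &+\sum_{k=M}^\infty \frac{q^{k(k+1)}}{(1-q)(1-tq^2)(1-q^3)\cdots(1-q^{M-1})(1-wq^{M})(1-q^{M+1})\cdots(1-q^k)}\\ &=\frac{1-q^{M}}{1-wq^{M}}\cdot\frac{1}{(1-tq^2)(1-q^3)\prod_{j\ge1}(1-q^{5j+2})(1-q^{5j+3})}. \end{aligned} $$ Moreover, the numerators on the left-hand side, namely $q^2(t+q)$, $q^6\left([M]_q+(w-1)(q^{M-3}+q^{M-6})\right)$, $q^{k(k+1)}[M]_q$ for $3\le k\le M-1$, and $q^{k(k+1)}$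 for $k\ge M$, are polynomials in $t,w,q$ with nonnegative integer coefficients. -/

import Mathlib

open scoped PowerSeries.WithPiTopology

/-- The coefficient ring `ℤ[t, w]`. -/
abbrev WeightRing : Type := MvPolynomial (Fin 2) ℤ

/-- `ℤ[t, w]` carries the discrete topology, so that convergence in `ℤ[t, w]⟦q⟧` is the usual
formal one: every coefficient of `q ^ n` is eventually constant. -/
instance instTopologicalSpaceWeightRing : TopologicalSpace WeightRing := ⊥

instance instDiscreteTopologyWeightRing : DiscreteTopology WeightRing := ⟨rfl⟩

/-- The ring `ℤ[t, w]⟦q⟧`. -/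
abbrev QSeries : Type := PowerSeries WeightRing

/-- The ring `ℤ[t, w][q]`, where the numerators live. -/
abbrev QPoly : Type := Polynomial WeightRing

namespace WeightedRR

noncomputable section

/-- The weight `t` of the part `2`. -/
def t : WeightRing := MvPolynomial.X 0

/-- The weight `w` of the part `M`. -/
def w : WeightRing := MvPolynomial.X 1

/-- The variable `q`, as a polynomial. -/
def q : QPoly := Polynomial.X

/-- The `q`-integer `[M]_q = 1 + q + ⋯ + q ^ (M - 1)`. -/
def qInt (M : ℕ) : QPoly := ∑ i ∈ Finset.range M, q ^ i

/-- The factor `1 - c q ^ n`. -/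
def factor (c : WeightRing) (n : ℕ) : QSeries :=
  1 - PowerSeries.C c * PowerSeries.X ^ n

/-- The quotient `f / g` of power series, for `g` with constant term `1`. -/
def quot (f g : QSeries) : QSeries := f * PowerSeries.invOfUnit g 1

theorem quot_mul_self (f g : QSeries) (hg : PowerSeries.constantCoeff g = 1) :
    quot f g * g = f := by
  rw [quot, mul_assoc, mul_comm (PowerSeries.invOfUnit g 1),
    PowerSeries.mul_invOfUnit g 1 (by simpa using hg), mul_one]

/-- All coefficients of a polynomial in `t, w, q` are nonnegative integers. -/
def HasNonnegCoeffs (p : QPoly) : Prop :=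
  ∀ (n : ℕ) (m : Fin 2 →₀ ℕ), 0 ≤ MvPolynomial.coeff m (p.coeff n)

/-- Numerator of the one-part term: `q ^ 2 (t + q)`. -/
def num₁ : QPoly := q ^ 2 * (Polynomial.C t + q)

/-- Numerator of the two-part term: `q ^ 6 ([M]_q + (w - 1) (q ^ (M - 3) + q ^ (M - 6)))`. -/
def num₂ (M : ℕ) : QPoly :=
  q ^ 6 * (qInt M + (Polynomial.C w - 1) * (q ^ (M - 3) + q ^ (M - 6)))

/-- Numerator of the `k`-part term for `3 ≤ k ≤ M - 1`: `q ^ (k (k + 1)) [M]_q`. -/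
def numMid (M k : ℕ) : QPoly := q ^ (k * (k + 1)) * qInt M

/-- Numerator of the `k`-part term for `k ≥ M`: `q ^ (k (k + 1))`. -/
def numTail (k : ℕ) : QPoly := q ^ (k * (k + 1))

/-- `(1 - t q^2) (1 - q^3) (1 - q^4) ⋯ (1 - q^k) (1 - w q^M)`. -/
def denMid (M k : ℕ) : QSeries :=
  factor t 2 * (∏ i ∈ Finset.Icc 3 k, factor 1 i) * factor w M

/-- `(1 - q) (1 - t q^2) (1 - q^3) ⋯ (1 - q^(M-1)) (1 - w q^M) (1 - q^(M+1)) ⋯ (1 - q^k)`. -/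
def denTail (M k : ℕ) : QSeries :=
  factor 1 1 * factor t 2 * (∏ i ∈ Finset.Icc 3 (M - 1), factor 1 i) * factor w M *
    ∏ i ∈ Finset.Icc (M + 1) k, factor 1 i

/-- The `k`-part term of the sum side for `k ≥ M`. -/
def tailTerm (M k : ℕ) : QSeries := quot (numTail k : QSeries) (denTail M k)

/-- The factors `(1 - q^(5k+7)) (1 - q^(5k+8))`, for `k = 0, 1, 2, …`, of the product side. -/
def prodFactor (k : ℕ) : QSeries := factor 1 (5 * k + 7) * factor 1 (5 * k + 8)

end

end WeightedRR

/-! The identity is the second Rogers–Ramanujan identity `∑ q^(k(k+1)) / (q)_k = ∏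
1/((1-q^(5j+2))(1-q^(5j+3)))`, where `(q)_k = (1-q)⋯(1-q^k)`, multiplied by `(1-q^2)(1-q^M) /
((1-tq^2)(1-wq^M))`. For `k ≥ M` both numerator factors cancel against `(q)_k`. For `3 ≤ k < M`,
`1-q^2` cancels and `(1-q^M)/(1-q)` becomes `[M]_q`. The terms `k = 0, 1, 2` regroup into the `1`
and the first two fractions (`initial_terms`).

Rogers–Ramanujan itself is proved by comparing two families indexed by `i`: the Rogers sums `∑
q^(k^2+ik)/(q)_k`, taken at `i+1` and multiplied by the Euler product, and Selberg's alternating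
series. Both satisfy `f_i = f_(i+1) + q^(i+2) f_(i+2)` and have the same limit as `i → ∞`, so they
agree (`pow_dvd_selbergSum_sub_rogersSum`). At `i = 0` Selberg's series is a theta series, which the
Jacobi triple product in base `q^5` turns into a product (`X_pow_dvd_jacobi_five`). Everything is
done with finite sums modulo `q^n`; the limit is taken only in `rogers_ramanujan`. -/

namespace RogersRamanujan

open Finset

/-! ### Gaussian binomials and the finite Jacobi triple product. -/

section CommRing

variable {R : Type*} [CommRing R]

/-- The product `(1 - q) (1 - q ^ 2) ⋯ (1 - q ^ n)`. -/
def eulerProd (q : R) (n : ℕ) : R := ∏ i ∈ range n, (1 - q ^ (i + 1))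

/-- The Gaussian binomial coefficient, defined by the `q`-Pascal rule. -/
def gaussBinom (q : R) : ℕ → ℕ → R
  | _, 0 => 1
  | 0, _ + 1 => 0
  | n + 1, k + 1 => gaussBinom q n k + q ^ (k + 1) * gaussBinom q n (k + 1)

@[simp] theorem eulerProd_zero (q : R) : eulerProd q 0 = 1 := by simp [eulerProd]

theorem eulerProd_succ (q : R) (n : ℕ) :
    eulerProd q (n + 1) = eulerProd q n * (1 - q ^ (n + 1)) := prod_range_succ _ _

@[simp] theorem gaussBinom_zero_right (q : R) (n : ℕ) : gaussBinom q n 0 = 1 := by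
  cases n <;> rfl

theorem gaussBinom_succ_succ (q : R) (n k : ℕ) :
    gaussBinom q (n + 1) (k + 1) = gaussBinom q n k + q ^ (k + 1) * gaussBinom q n (k + 1) := rfl

theorem gaussBinom_eq_zero_of_lt (q : R) : ∀ {n k : ℕ}, n < k → gaussBinom q n k = 0
  | 0, _ + 1, _ => rfl
  | n + 1, k + 1, h => by
    rw [gaussBinom_succ_succ, gaussBinom_eq_zero_of_lt q (by omega : n < k),
      gaussBinom_eq_zero_of_lt q (by omega : n < k + 1)]
    simp

theorem gaussBinom_self (q : R) (n : ℕ) : gaussBinom q n n = 1 := by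
  induction n with
  | zero => rfl
  | succ n ih => rw [gaussBinom_succ_succ, ih, gaussBinom_eq_zero_of_lt q n.lt_succ_self]; simp

/-- The factorial formula without division. The induction rests on `1 - q^(m+k+2) = (1 - q^(k+1)) +
q^(k+1) (1 - q^(m+1))`. -/
theorem gaussBinom_mul_eulerProd (q : R) : ∀ m k : ℕ,
    gaussBinom q (m + k) k * eulerProd q k * eulerProd q m = eulerProd q (m + k)
  | m, 0 => by simp
  | 0, k + 1 => by simp [gaussBinom_self]
  | m + 1, k + 1 => by
    have h₁ := gaussBinom_mul_eulerProd q (m + 1) k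
    have h₂ := gaussBinom_mul_eulerProd q m (k + 1)
    rw [show m + (k + 1) = m + 1 + k by ring] at h₂
    rw [show m + 1 + (k + 1) = m + 1 + k + 1 by ring, gaussBinom_succ_succ,
      eulerProd_succ q (m + 1 + k)]
    rw [eulerProd_succ q k] at h₂ ⊢
    rw [eulerProd_succ q m] at h₁ ⊢
    linear_combination (1 - q ^ (k + 1)) * h₁ + q ^ (k + 1) * (1 - q ^ (m + 1)) * h₂

/-- The `q`-binomial theorem. -/
theorem prod_add_mul_pow (q a : R) (n : ℕ) : ∀ b : R, ∏ i ∈ range n, (a + b * q ^ i) =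
    ∑ k ∈ range (n + 1), gaussBinom q n k * q ^ (k.choose 2) * b ^ k * a ^ (n - k) := by
  induction n with
  | zero => simp
  | succ n ih =>
    intro b
    have h : ∏ i ∈ range n, (a + b * q ^ (i + 1)) = ∏ i ∈ range n, (a + (b * q) * q ^ i) :=
      prod_congr rfl fun i _ => by ring
    rw [prod_range_succ', h, ih (b * q), sum_range_succ' _ (n + 1), mul_add, sum_mul, pow_zero,
      mul_one]
    have h₁ : ∀ k ∈ range (n + 1),
        gaussBinom q (n + 1) (k + 1) * q ^ ((k + 1).choose 2) * b ^ (k + 1) * a ^ (n + 1 - (k + 1))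
        = gaussBinom q n k * q ^ (k.choose 2) * (b * q) ^ k * a ^ (n - k) * b
          + gaussBinom q n (k + 1) * q ^ ((k + 1).choose 2) * (b * q) ^ (k + 1)
              * a ^ (n + 1 - (k + 1)) := by
      intro k _
      rw [gaussBinom_succ_succ, Nat.add_sub_add_right,
        show (k + 1).choose 2 = k + k.choose 2 by rw [Nat.choose_succ_succ' k 1]; simp]
      ring
    rw [sum_congr rfl h₁, sum_add_distrib, ← sum_mul, ← sum_mul]
    have h₂ := sum_range_succ'
      (fun k => gaussBinom q n k * q ^ (k.choose 2) * (b * q) ^ k * a ^ (n + 1 - k)) (n + 1)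
    rw [sum_range_succ, gaussBinom_eq_zero_of_lt q n.lt_succ_self] at h₂
    have h₃ : ∑ k ∈ range (n + 1), gaussBinom q n k * q ^ (k.choose 2) * (b * q) ^ k
          * a ^ (n + 1 - k)
        = (∑ k ∈ range (n + 1), gaussBinom q n k * q ^ (k.choose 2) * (b * q) ^ k
          * a ^ (n - k)) * a := by
      rw [sum_mul]
      refine sum_congr rfl fun k hk => ?_
      rw [show n + 1 - k = n - k + 1 by have := mem_range.1 hk; omega]
      ring
    rw [h₃] at h₂
    simp only [gaussBinom_zero_right, Nat.choose_zero_succ, pow_zero, Nat.sub_zero] at h₂ ⊢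
    linear_combination h₂

/-- The coefficient of the `k`-th term in the finite Jacobi triple product, centred at `n`. -/
def thetaTerm (q x y : R) (n k : ℕ) : R :=
  if n ≤ k then (-x) ^ (k - n) * q ^ ((k - n).choose 2)
  else (-y) ^ (n - k) * q ^ ((n - k).choose 2)

theorem thetaTerm_add (q x y : R) (n j : ℕ) :
    thetaTerm q x y n (n + j) = (-x) ^ j * q ^ (j.choose 2) := by
  simp [thetaTerm]

theorem thetaTerm_self_add (q x y : R) (k j : ℕ) :
    thetaTerm q x y (k + j) k = (-y) ^ j * q ^ (j.choose 2) := by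
  rcases Nat.eq_zero_or_pos j with rfl | hj
  · simp [thetaTerm]
  · rw [thetaTerm, if_neg (by omega), Nat.add_sub_cancel_left]

theorem choose_two_add (a b : ℕ) : (a + b).choose 2 = a.choose 2 + b.choose 2 + a * b := by
  induction b with
  | zero => simp
  | succ b ih =>
    rw [← add_assoc, Nat.choose_succ_succ' (a + b) 1, ih, Nat.choose_succ_succ' b 1]
    simp only [Nat.choose_one_right]
    ring

/-- The finite Jacobi triple product, up to a monomial factor. -/
theorem monomial_mul_finite_jacobi {q x y : R} (hxy : x * y = q) (n : ℕ) :
    (-x) ^ n * q ^ (n.choose 2 + n * n) *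
      ∏ i ∈ range n, ((1 - x * q ^ i) * (1 - y * q ^ i)) =
    (-x) ^ n * q ^ (n.choose 2 + n * n) *
      ∑ k ∈ range (2 * n + 1), gaussBinom q (2 * n) k * thetaTerm q x y n k := by
  -- Taking `a = q^n` over `2n` factors stands in for negative powers of `q`: the upper half of the
  -- product yields the `x`-factors, the lower half the `y`-factors.
  have hG := prod_add_mul_pow q (q ^ n) (2 * n) (-x)
  have hL : ∏ i ∈ range (2 * n), (q ^ n + (-x) * q ^ i) = (-x) ^ n * q ^ (n.choose 2 + n * n) *
      ∏ i ∈ range n, ((1 - x * q ^ i) * (1 - y * q ^ i)) := by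
    have h₁ : ∏ i ∈ range n, (q ^ n + (-x) * q ^ (n + i)) =
        q ^ (n * n) * ∏ i ∈ range n, (1 - x * q ^ i) := by
      have : ∀ i ∈ range n, q ^ n + (-x) * q ^ (n + i) = q ^ n * (1 - x * q ^ i) :=
        fun i _ => by ring
      rw [prod_congr rfl this, prod_mul_distrib, prod_const, card_range, pow_mul]
    -- With the order of factors reversed, `x y = q` lets `-x q^(n-1-i)` be pulled out of each.
    have h₂ : ∏ i ∈ range n, (q ^ n + (-x) * q ^ i) =
        (-x) ^ n * q ^ (n.choose 2) * ∏ i ∈ range n, (1 - y * q ^ i) := by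
      have : ∀ i ∈ range n, q ^ n + (-x) * q ^ (n - 1 - i) =
          (-x) * q ^ (n - 1 - i) * (1 - y * q ^ i) := by
        intro i hi
        have hi := mem_range.1 hi
        have : q ^ n = x * y * (q ^ (n - 1 - i) * q ^ i) := by
          rw [hxy, ← pow_add, ← pow_succ']
          congr 1
          omega
        rw [this]
        ring
      rw [← prod_range_reflect, prod_congr rfl this, prod_mul_distrib, prod_mul_distrib,
        prod_range_reflect (fun i => q ^ i), prod_const, card_range, prod_pow_eq_pow_sum,
        sum_range_id, Nat.choose_two_right]
    rw [two_mul, prod_range_add, h₁, h₂, prod_mul_distrib]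
    ring
  rw [← hL, hG, mul_sum]
  refine sum_congr rfl fun k hk => ?_
  have hk := mem_range.1 hk
  rcases le_total n k with h | h
  · obtain ⟨j, rfl⟩ := Nat.exists_eq_add_of_le h
    obtain ⟨i, rfl⟩ := Nat.exists_eq_add_of_le (show j ≤ n by omega)
    rw [thetaTerm_add, choose_two_add (j + i) j, ← pow_mul,
      show 2 * (j + i) - (j + i + j) = i by omega]
    ring
  · obtain ⟨j, rfl⟩ := Nat.exists_eq_add_of_le h
    have h₁ : (-x) ^ j * (-y) ^ j = q ^ j := by rw [← mul_pow, neg_mul_neg, hxy]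
    have h₂ : 2 * j.choose 2 + j = j * j := by
      rw [Nat.choose_two_right, Nat.mul_div_cancel' (Nat.even_mul_pred_self j).two_dvd]
      cases j <;> simp [Nat.mul_succ]
    have h₃ : q ^ (k.choose 2) * q ^ ((k + j) * (k + 2 * j)) =
        q ^ ((k + j).choose 2 + (k + j) * (k + j)) * q ^ j * q ^ (j.choose 2) := by
      rw [← pow_add, ← pow_add, ← pow_add, choose_two_add]
      congr 1
      linarith
    rw [thetaTerm_self_add, ← pow_mul, show 2 * (k + j) - k = k + 2 * j by omega, pow_add (-x)]
    linear_combination (gaussBinom q (2 * (k + j)) k * (-x) ^ k) * h₃ -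
      (gaussBinom q (2 * (k + j)) k * (-x) ^ k * q ^ ((k + j).choose 2 + (k + j) * (k + j)) *
        q ^ (j.choose 2)) * h₁

/-! ### Selberg's series and its recurrence. -/

/-- The sign times the generalised pentagonal-type power `q ^ (k (5 k - 1) / 2)`. -/
def signedPow (q : R) : ℕ → R
  | 0 => 1
  | k + 1 => -q ^ (5 * k + 2) * signedPow q k

/-- The product `(1 - q ^ (k + 1)) ⋯ (1 - q ^ (k + i))`. -/
def shiftedProd (q : R) (i k : ℕ) : R := ∏ m ∈ range i, (1 - q ^ (k + 1 + m))

theorem shiftedProd_succ (q : R) (i k : ℕ) :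
    shiftedProd q (i + 1) k = shiftedProd q i k * (1 - q ^ (k + 1 + i)) := prod_range_succ _ _

theorem mul_shiftedProd_succ (q : R) (i k : ℕ) :
    (1 - q ^ (k + 1)) * shiftedProd q i (k + 1) = shiftedProd q (i + 1) k := by
  rw [shiftedProd, shiftedProd, prod_range_succ', mul_comm]
  simp [add_comm, add_left_comm]

/-- The terms of the series that solves the Rogers–Ramanujan recurrence. -/
def selbergTerm (q : R) (i k : ℕ) : R :=
  signedPow q k * q ^ (2 * (i + 1) * k) * (1 - q ^ (i + 1 + 2 * k)) * shiftedProd q i k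

/-- The partial sums of the series that solves the Rogers–Ramanujan recurrence. -/
def selbergSum (q : R) (n i : ℕ) : R := ∑ k ∈ range n, selbergTerm q i k

/-- The boundary term in the recurrence for `selbergSum`. -/
def selbergBoundary (q : R) (i k : ℕ) : R :=
  signedPow q k * q ^ (2 * (i + 1) * k) * (1 - q ^ k) *
    (shiftedProd q i k + q ^ k * shiftedProd q (i + 1) k)

/-- Telescoping: the defect of the recurrence on the `k`-th terms is a difference of consecutive
values of `selbergBoundary`, which vanishes at `k = 0` because of its factor `1 - q^k`. -/
theorem selbergSum_recurrence (q : R) (n i : ℕ) :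
    selbergSum q n i = selbergSum q n (i + 1) + q ^ (i + 2) * selbergSum q n (i + 2)
      - selbergBoundary q i n := by
  induction n with
  | zero => simp [selbergSum, selbergBoundary]
  | succ n ih =>
    simp only [selbergSum, sum_range_succ] at ih ⊢
    have h₁ := mul_shiftedProd_succ q i n
    have h₂ := mul_shiftedProd_succ q (i + 1) n
    have h : selbergTerm q i n + selbergBoundary q i (n + 1) = selbergTerm q (i + 1) n
        + q ^ (i + 2) * selbergTerm q (i + 2) n + selbergBoundary q i n := by
      -- The factor `1 - q^(n+1)` is absorbed into the shifted products, so that all of them start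
      -- at the same `n`.
      have e : selbergBoundary q i (n + 1) = signedPow q (n + 1) * q ^ (2 * (i + 1) * (n + 1)) *
          (shiftedProd q (i + 1) n + q ^ (n + 1) * shiftedProd q (i + 2) n) := by
        rw [selbergBoundary, ← h₁, ← h₂]
        ring
      rw [e]
      simp only [selbergTerm, selbergBoundary, signedPow]
      rw [shiftedProd_succ q (i + 1), shiftedProd_succ q i]
      ring
    linear_combination ih + h

end CommRing
end RogersRamanujan

namespace RogersRamanujan

open Finset

/-! ### Comparison of the two families modulo `q^n`. -/

section Congruences

variable {R : Type*} [CommRing R]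

theorem pow_dvd_eulerProd_sub {q : R} {m n : ℕ} (h : m ≤ n) :
    q ^ m ∣ eulerProd q n - eulerProd q m := by
  induction n, h using Nat.le_induction with
  | base => simp
  | succ n h ih =>
    rw [eulerProd_succ, show eulerProd q n * (1 - q ^ (n + 1)) - eulerProd q m =
      (eulerProd q n - eulerProd q m) - q ^ (n + 1) * eulerProd q n by ring]
    exact dvd_sub ih (Dvd.dvd.mul_right (pow_dvd_pow q (by omega)) _)

/-- Modulo `q^a` the Euler products of lengths `m`, `k` and `m + k` coincide, so the factorial
formula reads `G E^2 ≡ E`, and the unit `E` cancels. -/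
theorem pow_dvd_gaussBinom_mul_sub_one {q : R} {m k a : ℕ} (hm : a ≤ m) (hk : a ≤ k)
    (hu : IsUnit (eulerProd q (m + k))) :
    q ^ a ∣ gaussBinom q (m + k) k * eulerProd q (m + k) - 1 := by
  have h := gaussBinom_mul_eulerProd q m k
  obtain ⟨u, hu'⟩ := (pow_dvd_pow q hm).trans (pow_dvd_eulerProd_sub (q := q) (Nat.le_add_right m k))
  obtain ⟨v, hv⟩ := (pow_dvd_pow q hk).trans (pow_dvd_eulerProd_sub (q := q) (Nat.le_add_left k m))
  rw [← hu.dvd_mul_right]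
  refine ⟨gaussBinom q (m + k) k * (eulerProd q (m + k) * u + eulerProd q m * v), ?_⟩
  linear_combination gaussBinom q (m + k) k * eulerProd q (m + k) * hu' +
    gaussBinom q (m + k) k * eulerProd q m * hv + h

/-- Partial sums of `∑ q ^ (k ^ 2 + i k) / ((1 - q) ⋯ (1 - q ^ k))`, where `h k` is the inverse of
the denominator. -/
def rogersSum (q : R) (h : ℕ → R) (n i : ℕ) : R := ∑ k ∈ range n, q ^ (k * k + i * k) * h k

/-- Subtracting the sums at `i` and `i + 1` puts `1 - q^k` in the `k`-th term; it cancels the last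
factor of the denominator and shifts the index by one. The correction is the term lost to
truncation. -/
theorem rogersSum_recurrence {q : R} {h : ℕ → R} (hh : ∀ k, h k = (1 - q ^ (k + 1)) * h (k + 1))
    (n i : ℕ) : rogersSum q h n i = rogersSum q h n (i + 1)
      + q ^ (i + 1) * rogersSum q h n (i + 2) - q ^ (n * n + i * n) * (1 - q ^ n) * h n := by
  induction n with
  | zero => simp [rogersSum]
  | succ n ih =>
    simp only [rogersSum, sum_range_succ] at ih ⊢
    rw [ih, mul_assoc _ _ (h (n + 1)), ← hh n]
    ring

theorem pow_dvd_signedPow (q : R) (n : ℕ) : q ^ n ∣ signedPow q n := by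
  induction n with
  | zero => simp
  | succ n ih =>
    rw [signedPow, pow_succ']
    refine mul_dvd_mul ?_ ih
    rw [dvd_neg]
    exact dvd_pow_self q (by omega)

theorem shiftedProd_zero_right (q : R) (i : ℕ) : shiftedProd q i 0 = eulerProd q i := by
  simp [shiftedProd, eulerProd, add_comm]

theorem pow_dvd_selbergSum_sub {q : R} {n i : ℕ} (h : n ≤ i) :
    q ^ n ∣ selbergSum q n i - eulerProd q n := by
  rcases n with - | n
  · simp
  have h₀ : selbergTerm q i 0 = eulerProd q (i + 1) := by
    simp [selbergTerm, signedPow, shiftedProd_zero_right, eulerProd_succ, mul_comm]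
  rw [selbergSum, sum_range_succ', h₀, add_sub_assoc]
  refine dvd_add (dvd_sum fun k _ => ?_) (pow_dvd_eulerProd_sub (by omega))
  rw [selbergTerm]
  refine Dvd.dvd.mul_right (Dvd.dvd.mul_right (Dvd.dvd.mul_left (pow_dvd_pow q ?_) _) _) _
  nlinarith

theorem pow_dvd_rogersSum_sub_one {q : R} {h : ℕ → R} (h₀ : h 0 = 1) {n i : ℕ} (hi : n ≤ i) :
    q ^ n ∣ rogersSum q h n i - 1 := by
  rcases n with - | n
  · simp
  rw [rogersSum, sum_range_succ', h₀]
  simp only [mul_zero, add_zero, pow_zero, mul_one, add_sub_cancel_right]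
  exact dvd_sum fun k _ => Dvd.dvd.mul_right (pow_dvd_pow q (by nlinarith)) _

/-- Downward induction on `i`, with `m` bounding the distance to `n`. For `i ≥ n` only the `k = 0`
terms survive modulo `q^n`; below that the common recurrence applies, since both boundary terms are
divisible by `q^n`. -/
theorem pow_dvd_selbergSum_sub_rogersSum {q : R} {h : ℕ → R} (h₀ : h 0 = 1)
    (hh : ∀ k, h k = (1 - q ^ (k + 1)) * h (k + 1)) (n : ℕ) : ∀ m i, n ≤ i + m →
      q ^ n ∣ selbergSum q n i - eulerProd q n * rogersSum q h n (i + 1) := by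
  intro m
  induction m with
  | zero =>
    intro i hi
    have h₁ := pow_dvd_selbergSum_sub (q := q) (n := n) (i := i) hi
    have h₂ := pow_dvd_rogersSum_sub_one (q := q) h₀ (show n ≤ i + 1 by omega)
    convert dvd_sub h₁ (h₂.mul_left (eulerProd q n)) using 1
    ring
  | succ m ih =>
    intro i hi
    have h₁ := ih (i + 1) (by omega)
    have h₂ := ih (i + 2) (by omega)
    have h₃ : q ^ n ∣ selbergBoundary q i n := by
      rw [selbergBoundary, mul_assoc, mul_assoc]
      exact (pow_dvd_signedPow q n).mul_right _
    have h₄ : q ^ n ∣ eulerProd q n * (q ^ (n * n + (i + 1) * n) * (1 - q ^ n) * h n) := by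
      refine Dvd.dvd.mul_left ?_ _
      rw [mul_assoc]
      exact Dvd.dvd.mul_right (pow_dvd_pow q (by nlinarith)) _
    rw [selbergSum_recurrence, rogersSum_recurrence hh n (i + 1)]
    convert dvd_add (dvd_sub (dvd_add h₁ (h₂.mul_left (q ^ (i + 2)))) h₃) h₄ using 1
    ring

/-- The `k`-th Selberg term at `i = 0` pairs the theta term at distance `k` on the `y`-side with the
one at distance `k + 1` on the `x`-side; the outermost `y`-term is left over. -/
theorem sum_thetaTerm (q : R) (n : ℕ) :
    ∑ k ∈ range (2 * n + 1), thetaTerm (q ^ 5) q (q ^ 4) n k =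
      selbergSum q n 0 + (-q ^ 4) ^ n * (q ^ 5) ^ (n.choose 2) := by
  have hp : ∀ k, (-q ^ 4) ^ k * (q ^ 5) ^ (k.choose 2) = signedPow q k * q ^ (2 * k) := by
    intro k
    induction k with
    | zero => simp [signedPow]
    | succ k ih =>
      rw [Nat.choose_succ_succ' k 1, Nat.choose_one_right, signedPow]
      linear_combination (-q ^ 4 * (q ^ 5) ^ k) * ih
  have hr : ∀ k, (-q) ^ (k + 1) * (q ^ 5) ^ ((k + 1).choose 2) =
      -(signedPow q k * q ^ (4 * k + 1)) := by
    intro k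
    induction k with
    | zero => simp [signedPow]
    | succ k ih =>
      rw [Nat.choose_succ_succ' (k + 1) 1, Nat.choose_one_right, signedPow]
      linear_combination (-q * (q ^ 5) ^ (k + 1)) * ih
  have h₁ : ∑ k ∈ range n, thetaTerm (q ^ 5) q (q ^ 4) n k =
      ∑ k ∈ range n, signedPow q (k + 1) * q ^ (2 * (k + 1)) := by
    rw [← sum_range_reflect]
    refine sum_congr rfl fun k hk => ?_
    have hk := mem_range.1 hk
    obtain ⟨m, rfl⟩ := Nat.exists_eq_add_of_lt hk
    rw [show k + m + 1 - 1 - k = m by omega, show k + m + 1 = m + (k + 1) by ring,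
      thetaTerm_self_add, hp]
  have h₂ : ∑ k ∈ range (n + 1), thetaTerm (q ^ 5) q (q ^ 4) n (n + k) =
      1 - ∑ k ∈ range n, signedPow q k * q ^ (4 * k + 1) := by
    simp only [thetaTerm_add]
    rw [sum_range_succ', sum_congr rfl fun k _ => hr k]
    simp only [sum_neg_distrib, pow_zero, Nat.choose_zero_succ, mul_one]
    ring
  have h₃ := sum_range_succ' (fun k => signedPow q k * q ^ (2 * k)) n
  rw [sum_range_succ] at h₃
  have h₄ : selbergSum q n 0 = ∑ k ∈ range n, signedPow q k * q ^ (2 * k) -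
      ∑ k ∈ range n, signedPow q k * q ^ (4 * k + 1) := by
    rw [selbergSum, ← sum_sub_distrib]
    refine sum_congr rfl fun k _ => ?_
    simp only [selbergTerm, shiftedProd, range_zero, prod_empty]
    ring
  rw [show 2 * n + 1 = n + (n + 1) by ring, sum_range_add, h₁, h₂, h₄, hp]
  have h₅ : signedPow q 0 * q ^ (2 * 0) = 1 := by simp [signedPow]
  linear_combination -h₃ - h₅

end Congruences

/-! ### Rogers–Ramanujan as a congruence of power series. -/

section PowerSeries

open PowerSeries

variable {R : Type*} [CommRing R]

theorem constantCoeff_prod_one_sub_X_pow {ι : Type*} (s : Finset ι) (f : ι → ℕ)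
    (hf : ∀ i ∈ s, f i ≠ 0) :
    constantCoeff (∏ i ∈ s, (1 - (X : R⟦X⟧) ^ f i)) = 1 := by
  rw [map_prod]
  exact prod_eq_one fun i hi => by simp [hf i hi]

theorem isUnit_of_constantCoeff_eq_one {f : R⟦X⟧} (hf : constantCoeff f = 1) : IsUnit f :=
  isUnit_iff_constantCoeff.2 (hf ▸ isUnit_one)

theorem isUnit_prod_one_sub_X_pow {ι : Type*} (s : Finset ι) (f : ι → ℕ)
    (hf : ∀ i ∈ s, f i ≠ 0) : IsUnit (∏ i ∈ s, (1 - (X : R⟦X⟧) ^ f i)) :=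
  isUnit_of_constantCoeff_eq_one (constantCoeff_prod_one_sub_X_pow s f hf)

theorem eulerProd_X_pow_five (n : ℕ) : eulerProd ((X : R⟦X⟧) ^ 5) n =
    ∏ i ∈ range n, (1 - (X : R⟦X⟧) ^ (5 * i + 5)) :=
  prod_congr rfl fun i _ => by ring

theorem eulerProd_five_mul (q : R) (n : ℕ) : eulerProd q (5 * n) =
    (∏ i ∈ range n, (1 - q ^ (5 * i + 5))) *
      (∏ i ∈ range n, ((1 - q ^ (5 * i + 1)) * (1 - q ^ (5 * i + 4)))) *
      ∏ i ∈ range n, ((1 - q ^ (5 * i + 2)) * (1 - q ^ (5 * i + 3))) := by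
  induction n with
  | zero => simp
  | succ n ih =>
    rw [show 5 * (n + 1) = 5 * n + 1 + 1 + 1 + 1 + 1 by ring]
    simp only [eulerProd_succ, prod_range_succ, ih]
    ring

variable [IsDomain R]

/-- The Jacobi triple product for the modulus `5`, as a congruence. -/
theorem X_pow_dvd_jacobi_five (n : ℕ) :
    (X : R⟦X⟧) ^ n ∣ (∏ i ∈ range (2 * n), (1 - (X : R⟦X⟧) ^ (5 * i + 5))) *
      ∏ i ∈ range n, ((1 - (X : R⟦X⟧) ^ (5 * i + 1)) * (1 - (X : R⟦X⟧) ^ (5 * i + 4))) -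
        selbergSum X n 0 := by
  have hJ := monomial_mul_finite_jacobi (show (X : R⟦X⟧) * X ^ 4 = X ^ 5 by ring) n
  have hX : (X : R⟦X⟧) ≠ 0 := X_ne_zero
  -- The monomial factor is not a unit; cancelling it is where the domain hypothesis enters.
  have hJ := mul_left_cancel₀
    (mul_ne_zero (pow_ne_zero _ (neg_ne_zero.2 hX)) (pow_ne_zero _ (pow_ne_zero _ hX))) hJ
  have h₁ : ∏ i ∈ range n, ((1 - (X : R⟦X⟧) ^ (5 * i + 1)) * (1 - (X : R⟦X⟧) ^ (5 * i + 4))) =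
      ∏ i ∈ range n, ((1 - X * (X ^ 5) ^ i) * (1 - X ^ 4 * (X ^ 5) ^ i)) :=
    prod_congr rfl fun i _ => by ring
  have hu : IsUnit (eulerProd ((X : R⟦X⟧) ^ 5) (2 * n)) := by
    rw [eulerProd_X_pow_five]
    exact isUnit_prod_one_sub_X_pow _ _ fun _ _ => by omega
  -- At distance `j` from the centre the theta term supplies `X^j` and the Gaussian congruence the
  -- remaining `X^(n-j)`.
  have h₂ : (X : R⟦X⟧) ^ n ∣ ∑ k ∈ range (2 * n + 1), thetaTerm (X ^ 5) (X : R⟦X⟧) (X ^ 4) n k *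
      (gaussBinom (X ^ 5) (2 * n) k * eulerProd (X ^ 5) (2 * n) - 1) := by
    refine dvd_sum fun k hk => ?_
    have hk := mem_range.1 hk
    rcases le_total n k with h | h
    · obtain ⟨j, rfl⟩ := Nat.exists_eq_add_of_le h
      obtain ⟨i, rfl⟩ := Nat.exists_eq_add_of_le (show j ≤ n by omega)
      rw [show 2 * (j + i) = i + (j + i + j) by ring] at hu ⊢
      have := pow_dvd_gaussBinom_mul_sub_one le_rfl (by omega : i ≤ j + i + j) hu
      rw [thetaTerm_add, pow_add]
      refine mul_dvd_mul (Dvd.dvd.mul_right ?_ _) (dvd_trans ?_ this)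
      · exact pow_dvd_pow_of_dvd (dvd_neg.2 dvd_rfl) _
      · exact pow_dvd_pow_of_dvd (dvd_pow_self _ (by omega)) _
    · obtain ⟨j, rfl⟩ := Nat.exists_eq_add_of_le h
      rw [show 2 * (k + j) = k + 2 * j + k by ring] at hu ⊢
      have := pow_dvd_gaussBinom_mul_sub_one (by omega : k ≤ k + 2 * j) le_rfl hu
      rw [thetaTerm_self_add, pow_add, mul_comm ((X : R⟦X⟧) ^ k)]
      refine mul_dvd_mul (Dvd.dvd.mul_right ?_ _) (dvd_trans ?_ this)
      · exact pow_dvd_pow_of_dvd (dvd_neg.2 (dvd_pow_self _ (by omega))) _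
      · exact pow_dvd_pow_of_dvd (dvd_pow_self _ (by omega)) _
  have h₃ : (X : R⟦X⟧) ^ n ∣ (-X ^ 4) ^ n * (X ^ 5) ^ (n.choose 2) :=
    Dvd.dvd.mul_right (pow_dvd_pow_of_dvd (dvd_neg.2 (dvd_pow_self _ (by omega))) _) _
  convert dvd_add h₂ h₃ using 1
  rw [h₁, hJ]
  simp only [mul_sub, mul_one, sum_sub_distrib]
  rw [sum_thetaTerm, ← eulerProd_X_pow_five, mul_sum]
  have : ∀ k ∈ range (2 * n + 1), eulerProd ((X : R⟦X⟧) ^ 5) (2 * n) *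
      (gaussBinom (X ^ 5) (2 * n) k * thetaTerm (X ^ 5) X (X ^ 4) n k) =
      thetaTerm (X ^ 5) X (X ^ 4) n k *
        (gaussBinom (X ^ 5) (2 * n) k * eulerProd (X ^ 5) (2 * n)) := fun k _ => by ring
  rw [sum_congr rfl this]
  ring

/-- The second Rogers–Ramanujan identity, as a congruence between partial sums and products. -/
theorem X_pow_dvd_rogers_ramanujan {h : ℕ → R⟦X⟧} (h₀ : h 0 = 1)
    (hh : ∀ k, h k = (1 - X ^ (k + 1)) * h (k + 1)) (n : ℕ) :
    (X : R⟦X⟧) ^ n ∣ (∏ i ∈ range n, ((1 - X ^ (5 * i + 2)) * (1 - X ^ (5 * i + 3)))) *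
      rogersSum X h n 1 - 1 := by
  have h₁ := pow_dvd_selbergSum_sub_rogersSum h₀ hh n n 0 (by omega)
  have h₂ := X_pow_dvd_jacobi_five (R := R) n
  have h₃ : (X : R⟦X⟧) ^ n ∣ eulerProd (X ^ 5) (2 * n) - eulerProd (X ^ 5) n :=
    dvd_trans (pow_dvd_pow_of_dvd (dvd_pow_self _ (by omega)) _)
      (pow_dvd_eulerProd_sub (show n ≤ 2 * n by omega))
  have h₄ := pow_dvd_eulerProd_sub (q := (X : R⟦X⟧)) (show n ≤ 5 * n by omega)
  rw [eulerProd_X_pow_five, eulerProd_X_pow_five] at h₃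
  rw [eulerProd_five_mul] at h₄
  rw [zero_add] at h₁
  set A := ∏ i ∈ range n, (1 - (X : R⟦X⟧) ^ (5 * i + 5))
  set B := ∏ i ∈ range n, ((1 - (X : R⟦X⟧) ^ (5 * i + 1)) * (1 - (X : R⟦X⟧) ^ (5 * i + 4))) with hB
  have hu : IsUnit (A * B) := by
    refine (isUnit_prod_one_sub_X_pow _ _ fun _ _ => by omega).mul ?_
    rw [hB, prod_mul_distrib]
    exact (isUnit_prod_one_sub_X_pow _ _ fun _ _ => by omega).mul
      (isUnit_prod_one_sub_X_pow _ _ fun _ _ => by omega)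
  rw [← hu.dvd_mul_left]
  -- With `P` the target product, `E` the Euler product, `S` Selberg's sum and `T` the Rogers sum:
  -- `A B P T ≡ E T ≡ S ≡ A B`.
  convert dvd_add (dvd_sub (h₄.mul_right (rogersSum X h n 1)) h₁) (dvd_sub (h₃.mul_right B) h₂)
    using 1
  ring

end PowerSeries
end RogersRamanujan

namespace RogersRamanujan

open Finset PowerSeries Filter

/-! ### Passage to the limit. -/

section Limit

variable {R : Type*} [CommRing R] [TopologicalSpace R]

theorem tendsto_of_X_pow_dvd_sub {a : ℕ → R⟦X⟧} {b : R⟦X⟧} (h : ∀ n, X ^ n ∣ a n - b) :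
    Tendsto a atTop (nhds b) := by
  rw [WithPiTopology.tendsto_iff_coeff_tendsto]
  intro d
  refine tendsto_atTop_of_eventually_const (i₀ := d + 1) fun n hn => ?_
  have := X_pow_dvd_iff.1 (h n) d (by omega)
  rwa [map_sub, sub_eq_zero] at this

theorem summable_of_X_pow_dvd {a : ℕ → R⟦X⟧} (h : ∀ n, X ^ n ∣ a n) : Summable a := by
  apply WithPiTopology.summable_of_tendsto_order_atTop_nhds_top
  refine ENat.tendsto_nhds_top_iff_natCast_lt.mpr fun n => eventually_atTop.mpr ⟨n + 1, ?_⟩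
  intro m hm
  refine lt_of_lt_of_le ?_ (le_order _ m fun i hi => X_pow_dvd_iff.1 (h m) i (by exact_mod_cast hi))
  exact_mod_cast hm

theorem multipliable_one_sub_X_pow_of_le {f : ℕ → ℕ} (hf : ∀ n, n < f n) :
    Multipliable fun n => (1 : R⟦X⟧) - X ^ f n := by
  nontriviality R
  simp_rw [sub_eq_add_neg]
  apply WithPiTopology.multipliable_one_add_of_tendsto_order_atTop_nhds_top
  refine ENat.tendsto_nhds_top_iff_natCast_lt.mpr fun n => eventually_atTop.mpr ⟨n, ?_⟩
  intro m hm
  rw [order_neg, order_X_pow]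
  exact_mod_cast hm.trans_lt (hf m)

variable [IsDomain R] [IsTopologicalRing R] [T2Space R]

/-- The second Rogers–Ramanujan identity, with the first two factors of the product split off. -/
theorem rogers_ramanujan {h : ℕ → R⟦X⟧} (h₀ : h 0 = 1)
    (hh : ∀ k, h k = (1 - X ^ (k + 1)) * h (k + 1)) :
    (1 - (X : R⟦X⟧) ^ 2) * (1 - X ^ 3) *
      (∏' k : ℕ, ((1 - (X : R⟦X⟧) ^ (5 * k + 7)) * (1 - X ^ (5 * k + 8)))) *
      ∑' k : ℕ, X ^ (k * (k + 1)) * h k = 1 := by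
  have hs : Summable fun k => (X : R⟦X⟧) ^ (k * (k + 1)) * h k :=
    summable_of_X_pow_dvd fun n => Dvd.dvd.mul_right (pow_dvd_pow X (by nlinarith)) _
  have hm : Multipliable fun k : ℕ => (1 - (X : R⟦X⟧) ^ (5 * k + 7)) * (1 - X ^ (5 * k + 8)) :=
    (multipliable_one_sub_X_pow_of_le fun n => by omega).mul
      (multipliable_one_sub_X_pow_of_le fun n => by omega)
  have h₁ := tendsto_of_X_pow_dvd_sub (X_pow_dvd_rogers_ramanujan h₀ hh)
  -- The congruence is used at `n + 1`, so that its `i = 0` factors are the two standing in front of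
  -- the infinite product.
  have h₂ := (hm.hasProd.tendsto_prod_nat.const_mul
    ((1 - (X : R⟦X⟧) ^ 2) * (1 - X ^ 3))).mul
      (hs.hasSum.tendsto_sum_nat.comp (tendsto_add_atTop_nat 1))
  refine tendsto_nhds_unique h₂ ((h₁.comp (tendsto_add_atTop_nat 1)).congr fun n => ?_)
  simp only [Function.comp_apply, prod_range_succ' _ n, rogersSum]
  have e : ∀ k : ℕ, k * k + 1 * k = k * (k + 1) := fun k => by ring
  simp only [e]
  ring_nf

end Limit

end RogersRamanujan

/-! ### The weighted identity. -/

namespace WeightedRR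

open RogersRamanujan Finset PowerSeries

theorem factor_one (n : ℕ) : factor 1 n = 1 - X ^ n := by simp [factor]

theorem constantCoeff_factor (c : WeightRing) {n : ℕ} (hn : n ≠ 0) :
    constantCoeff (factor c n) = 1 := by simp [factor, hn]

theorem constantCoeff_prod_factor (s : Finset ℕ) (hs : ∀ i ∈ s, i ≠ 0) :
    constantCoeff (∏ i ∈ s, factor 1 i) = 1 := by
  simp_rw [factor_one]
  exact constantCoeff_prod_one_sub_X_pow s _ hs

theorem constantCoeff_eulerProd (n : ℕ) : constantCoeff (eulerProd (X : QSeries) n) = 1 :=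
  constantCoeff_prod_one_sub_X_pow _ _ fun _ _ => by omega

theorem eulerProd_eq_mul_prod_factor {m k : ℕ} (h : m ≤ k) :
    eulerProd (X : QSeries) k = eulerProd X m * ∏ i ∈ Icc (m + 1) k, factor 1 i := by
  induction k, h using Nat.le_induction with
  | base => simp
  | succ k h ih => rw [prod_Icc_succ_top (by omega), ← mul_assoc, ← ih, eulerProd_succ, factor_one]

/-- The reciprocal of `(1 - q) ⋯ (1 - q ^ k)`. -/
noncomputable def invEulerProd (k : ℕ) : QSeries := quot 1 (eulerProd X k)

theorem invEulerProd_mul (k : ℕ) : invEulerProd k * eulerProd X k = 1 :=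
  quot_mul_self _ _ (constantCoeff_eulerProd k)

theorem invEulerProd_zero : invEulerProd 0 = 1 := by simpa using invEulerProd_mul 0

theorem invEulerProd_eq (k : ℕ) :
    invEulerProd k = (1 - X ^ (k + 1)) * invEulerProd (k + 1) := by
  have h₁ := invEulerProd_mul k
  have h₂ := invEulerProd_mul (k + 1)
  rw [eulerProd_succ] at h₂
  linear_combination (-invEulerProd k) * h₂ + (1 - X ^ (k + 1)) * invEulerProd (k + 1) * h₁

theorem coe_qInt_mul (M : ℕ) : (qInt M : QSeries) * (1 - X) = 1 - X ^ M := by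
  have h := congrArg (fun p : QPoly => (p : QSeries)) (mul_neg_geom_sum q M)
  simpa [qInt, q, mul_comm] using h

variable {M k : ℕ}

theorem constantCoeff_denMid (hM : M ≠ 0) : constantCoeff (denMid M k) = 1 := by
  rw [denMid, map_mul, map_mul, constantCoeff_factor _ two_ne_zero, constantCoeff_factor _ hM,
    constantCoeff_prod_factor _ fun i hi => by have := mem_Icc.1 hi; omega]
  simp

theorem constantCoeff_denTail (hM : M ≠ 0) : constantCoeff (denTail M k) = 1 := by
  simp only [denTail, map_mul]
  rw [constantCoeff_factor _ two_ne_zero, constantCoeff_factor _ hM,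
    constantCoeff_factor _ one_ne_zero,
    constantCoeff_prod_factor _ fun i hi => by have := mem_Icc.1 hi; omega,
    constantCoeff_prod_factor _ fun i hi => by have := mem_Icc.1 hi; omega]
  simp

theorem eulerProd_two : eulerProd (X : QSeries) 2 = (1 - X) * (1 - X ^ 2) := by
  simp [eulerProd_succ]

theorem denMid_mul (hk : 2 ≤ k) : denMid M k * ((1 - X) * (1 - X ^ 2)) =
    eulerProd X k * (factor t 2 * factor w M) := by
  rw [denMid, eulerProd_eq_mul_prod_factor hk, eulerProd_two]
  ring

theorem denTail_mul (hM : 3 ≤ M) (hk : M ≤ k) : denTail M k * ((1 - X ^ 2) * (1 - X ^ M)) =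
    eulerProd X k * (factor t 2 * factor w M) := by
  obtain ⟨m, rfl⟩ := Nat.exists_eq_add_of_le' (show 1 ≤ M by omega)
  rw [denTail, eulerProd_eq_mul_prod_factor hk, eulerProd_succ,
    eulerProd_eq_mul_prod_factor (show 2 ≤ m by omega), eulerProd_two, Nat.add_sub_cancel,
    factor_one]
  ring

theorem quot_numMid_mul (hM : M ≠ 0) (hk : 2 ≤ k) :
    quot (numMid M k : QSeries) (denMid M k) * (factor t 2 * factor w M) =
      (1 - X ^ 2) * (1 - X ^ M) * (X ^ (k * (k + 1)) * invEulerProd k) := by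
  have h₁ := quot_mul_self (numMid M k : QSeries) (denMid M k) (constantCoeff_denMid hM)
  have h₂ := denMid_mul (M := M) hk
  have h₃ := invEulerProd_mul k
  have h₄ : (numMid M k : QSeries) = X ^ (k * (k + 1)) * (qInt M : QSeries) := by
    simp [numMid, q]
  have h₅ := coe_qInt_mul M
  rw [h₄] at h₁ ⊢
  generalize quot (X ^ (k * (k + 1)) * (qInt M : QSeries)) (denMid M k) = Q at h₁ ⊢
  linear_combination (-Q * (factor t 2 * factor w M)) * h₃ - invEulerProd k * Q * h₂ +
    invEulerProd k * ((1 - X) * (1 - X ^ 2)) * h₁ +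
    invEulerProd k * X ^ (k * (k + 1)) * (1 - X ^ 2) * h₅

theorem tailTerm_mul (hM : 3 ≤ M) (hk : M ≤ k) :
    tailTerm M k * (factor t 2 * factor w M) =
      (1 - X ^ 2) * (1 - X ^ M) * (X ^ (k * (k + 1)) * invEulerProd k) := by
  have h₁ := quot_mul_self (numTail k : QSeries) (denTail M k)
    (constantCoeff_denTail (by omega))
  have h₂ := denTail_mul hM hk
  have h₃ := invEulerProd_mul k
  have h₄ : (numTail k : QSeries) = X ^ (k * (k + 1)) := by simp [numTail, q]
  rw [h₄] at h₁
  rw [tailTerm, h₄]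
  generalize quot (X ^ (k * (k + 1))) (denTail M k) = Q at h₁ ⊢
  linear_combination (-Q * (factor t 2 * factor w M)) * h₃ - invEulerProd k * Q * h₂ +
    invEulerProd k * ((1 - X ^ 2) * (1 - X ^ M)) * h₁

theorem summable_tailTerm (M : ℕ) : Summable fun j => tailTerm M (M + j) := by
  refine summable_of_X_pow_dvd fun n => Dvd.dvd.mul_right ?_ _
  simp only [numTail, q, Polynomial.coe_pow, Polynomial.coe_X]
  exact pow_dvd_pow X (by nlinarith)

theorem prodFactor_eq (k : ℕ) : prodFactor k = (1 - X ^ (5 * k + 7)) * (1 - X ^ (5 * k + 8)) := by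
  rw [prodFactor, factor_one, factor_one]

theorem multipliable_prodFactor : Multipliable prodFactor := by
  simp_rw [funext prodFactor_eq]
  exact (multipliable_one_sub_X_pow_of_le fun n => by omega).mul
    (multipliable_one_sub_X_pow_of_le fun n => by omega)

theorem constantCoeff_tprod_prodFactor : constantCoeff (∏' k, prodFactor k) = 1 := by
  have h := (WithPiTopology.continuous_constantCoeff WeightRing).tendsto (∏' k, prodFactor k)
  refine tendsto_nhds_unique (h.comp multipliable_prodFactor.hasProd.tendsto_prod_nat)
    (tendsto_const_nhds.congr fun n => ?_)
  simp [prodFactor, constantCoeff_factor]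

/-- The first two summands on the left add up to `(1+q^3)(1-wq^M)`, while the terms `k = 0, 1` on
the right give `(1+q^3)(1-q^M)`. The discrepancy `(w-1)(q^M + q^(M+3))` is exactly the correction to
`q^6 [M]_q` in `num₂`. -/
theorem initial_terms (hM : 7 ≤ M) :
    factor t 2 * factor w M + (num₁ : QSeries) * factor w M + (num₂ M : QSeries) =
      (1 - X ^ 2) * (1 - X ^ M) *
        ∑ k ∈ range 3, X ^ (k * (k + 1)) * invEulerProd k := by
  have h₁ := invEulerProd_mul 1
  have h₂ := invEulerProd_mul 2
  rw [eulerProd_two] at h₂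
  have h₃ := coe_qInt_mul M
  obtain ⟨m, rfl⟩ := Nat.exists_eq_add_of_le' hM
  simp only [sum_range_succ, range_zero, sum_empty, invEulerProd_zero, eulerProd_succ,
    eulerProd_zero, zero_add, one_mul, pow_one] at h₁ ⊢
  simp only [num₁, num₂, q, factor, Polynomial.coe_mul, Polynomial.coe_add, Polynomial.coe_sub,
    Polynomial.coe_pow, Polynomial.coe_X, Polynomial.coe_C, Polynomial.coe_one,
    show m + 7 - 3 = m + 4 by omega, show m + 7 - 6 = m + 1 by omega]
  linear_combination (-(1 - X ^ (m + 7)) * (1 + X) * X ^ 2) * h₁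
    - (X ^ 6 * (qInt (m + 7) : QSeries)) * h₂
    + (X ^ 6 * (1 - X ^ 2) * invEulerProd 2) * h₃

theorem sum_side_eq_product_side (hM : 7 ≤ M) :
    1 + quot (num₁ : QSeries) (factor t 2) + quot (num₂ M : QSeries) (factor t 2 * factor w M)
      + ∑ k ∈ Icc 3 (M - 1), quot (numMid M k : QSeries) (denMid M k)
      + ∑' j : ℕ, tailTerm M (M + j) =
    quot (factor 1 M) (factor w M) *
      quot 1 (factor t 2 * factor 1 3 * ∏' k : ℕ, prodFactor k) := by
  have ht : constantCoeff (factor t 2) = 1 := constantCoeff_factor t two_ne_zero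
  have hw : constantCoeff (factor w M) = 1 := constantCoeff_factor w (by omega)
  have htw : constantCoeff (factor t 2 * factor w M) = 1 := by rw [map_mul, ht, hw, one_mul]
  have hF : constantCoeff (factor t 2 * factor 1 3 * ∏' k : ℕ, prodFactor k) = 1 := by
    rw [map_mul, map_mul, ht, constantCoeff_factor 1 three_ne_zero,
      constantCoeff_tprod_prodFactor, one_mul, one_mul]
  have hs : Summable fun k => (X : QSeries) ^ (k * (k + 1)) * invEulerProd k :=
    summable_of_X_pow_dvd fun n => Dvd.dvd.mul_right (pow_dvd_pow X (by nlinarith)) _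
  have hRR := rogers_ramanujan invEulerProd_zero invEulerProd_eq
  simp_rw [← prodFactor_eq] at hRR
  rw [← hs.sum_add_tsum_nat_add M, range_eq_Ico,
    ← sum_Ico_consecutive _ (Nat.zero_le 3) (show 3 ≤ M by omega), ← range_eq_Ico] at hRR
  have hIcc : Icc 3 (M - 1) = Ico 3 M := by ext; simp only [mem_Icc, mem_Ico]; omega
  have hmid : (∑ k ∈ Icc 3 (M - 1), quot (numMid M k : QSeries) (denMid M k)) *
      (factor t 2 * factor w M) = (1 - X ^ 2) * (1 - X ^ M) *
        ∑ k ∈ Ico 3 M, X ^ (k * (k + 1)) * invEulerProd k := by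
    rw [hIcc, sum_mul, mul_sum]
    exact sum_congr rfl fun k hk =>
      quot_numMid_mul (by omega) (by have := mem_Ico.1 hk; omega)
  have htail : (∑' j : ℕ, tailTerm M (M + j)) * (factor t 2 * factor w M) =
      (1 - X ^ 2) * (1 - X ^ M) *
        ∑' j : ℕ, X ^ ((j + M) * (j + M + 1)) * invEulerProd (j + M) := by
    rw [← (summable_tailTerm M).tsum_mul_right,
      ← ((summable_nat_add_iff M).2 hs).tsum_mul_left]
    refine tsum_congr fun j => ?_
    rw [add_comm j M, tailTerm_mul (by omega) (Nat.le_add_right M j)]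
  have hinit := initial_terms hM
  have h₁ := quot_mul_self (num₁ : QSeries) _ ht
  have h₂ := quot_mul_self (num₂ M : QSeries) _ htw
  have h₃ := quot_mul_self (factor 1 M) _ hw
  have h₄ := quot_mul_self 1 _ hF
  -- After clearing the unit `(1-tq^2)(1-wq^M)`, the rest is linear algebra over the identities
  -- collected above, with every quotient and infinite expression treated as an atom.
  refine (isUnit_of_constantCoeff_eq_one htw).mul_right_cancel ?_
  rw [factor_one] at h₃ h₄
  rw [factor_one M, factor_one 3]
  generalize quot (num₁ : QSeries) (factor t 2) = Q₁ at *
  generalize quot (num₂ M : QSeries) (factor t 2 * factor w M) = Q₂ at *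
  generalize quot (1 - X ^ M) (factor w M) = Q₃ at *
  generalize quot 1 (factor t 2 * (1 - X ^ 3) * ∏' k : ℕ, prodFactor k) = Q₄ at *
  generalize ∏' k : ℕ, prodFactor k = F at *
  generalize ∑' j : ℕ, tailTerm M (M + j) = S₁ at *
  generalize ∑ k ∈ Icc 3 (M - 1), quot (numMid M k : QSeries) (denMid M k) = S₂ at *
  generalize ∑' j : ℕ, (X : QSeries) ^ ((j + M) * (j + M + 1)) * invEulerProd (j + M) = G₁ at *
  generalize ∑ k ∈ Ico 3 M, (X : QSeries) ^ (k * (k + 1)) * invEulerProd k = G₂ at *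
  generalize ∑ k ∈ range 3, (X : QSeries) ^ (k * (k + 1)) * invEulerProd k = G₃ at *
  have hprod : Q₃ * Q₄ * (factor t 2 * factor w M) =
      (1 - X ^ M) * ((1 - X ^ 2) * (G₃ + G₂ + G₁)) := by
    linear_combination Q₄ * factor t 2 * h₃
      + (1 - X ^ M) * (1 - X ^ 2) * (G₃ + G₂ + G₁) * h₄
      - (1 - X ^ M) * Q₄ * factor t 2 * hRR
  linear_combination hinit + factor w M * h₁ + h₂ + hmid + htail - hprod

/-! ### Nonnegativity of the numerators. -/

/-- The subsemiring of polynomials whose coefficients come from `ℕ`. -/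
noncomputable def natCoeffs : Subsemiring QPoly :=
  (Polynomial.mapRingHom (MvPolynomial.map (σ := Fin 2) (Nat.castRingHom ℤ))).rangeS

theorem hasNonnegCoeffs_of_mem {p : QPoly} (hp : p ∈ natCoeffs) : HasNonnegCoeffs p := by
  obtain ⟨p, rfl⟩ := hp
  intro n m
  simp [MvPolynomial.coeff_map]

theorem q_mem_natCoeffs : q ∈ natCoeffs := ⟨Polynomial.X, by simp [q]⟩

theorem C_t_mem_natCoeffs : Polynomial.C t ∈ natCoeffs :=
  ⟨Polynomial.C (MvPolynomial.X 0), by simp [t]⟩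

theorem C_w_mem_natCoeffs : Polynomial.C w ∈ natCoeffs :=
  ⟨Polynomial.C (MvPolynomial.X 1), by simp [w]⟩

theorem qInt_mem_natCoeffs (M : ℕ) : qInt M ∈ natCoeffs :=
  sum_mem fun _ _ => pow_mem q_mem_natCoeffs _

theorem num₁_mem_natCoeffs : num₁ ∈ natCoeffs :=
  mul_mem (pow_mem q_mem_natCoeffs _) (add_mem C_t_mem_natCoeffs q_mem_natCoeffs)

theorem num₂_mem_natCoeffs (hM : 7 ≤ M) : num₂ M ∈ natCoeffs := by
  obtain ⟨m, rfl⟩ := Nat.exists_eq_add_of_le' hM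
  -- The two negative monomials cancel the powers `m + 1` and `m + 4` of `[M]_q`, leaving a
  -- subtraction-free form.
  have h : num₂ (m + 7) = q ^ 6 * (qInt (m + 1) + q ^ (m + 2) + q ^ (m + 3) + q ^ (m + 5)
      + q ^ (m + 6) + Polynomial.C w * (q ^ (m + 4) + q ^ (m + 1))) := by
    simp only [num₂, qInt, sum_range_succ, show m + 7 - 3 = m + 4 by omega,
      show m + 7 - 6 = m + 1 by omega]
    ring
  have hq := fun n => pow_mem q_mem_natCoeffs n
  rw [h]
  exact mul_mem (hq _) (add_mem (add_mem (add_mem (add_mem (add_mem (qInt_mem_natCoeffs _) (hq _))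
    (hq _)) (hq _)) (hq _)) (mul_mem C_w_mem_natCoeffs (add_mem (hq _) (hq _))))

end WeightedRR

theorem mainTheorem7 (M : ℕ) (hM : 7 ≤ M) (hmod : M % 5 = 2 ∨ M % 5 = 3) :
    Summable (fun j : ℕ => WeightedRR.tailTerm M (M + j)) ∧
    Multipliable WeightedRR.prodFactor ∧
    1 + WeightedRR.quot (WeightedRR.num₁ : QSeries) (WeightedRR.factor WeightedRR.t 2)
      + WeightedRR.quot (WeightedRR.num₂ M : QSeries)
          (WeightedRR.factor WeightedRR.t 2 * WeightedRR.factor WeightedRR.w M)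
      + ∑ k ∈ Finset.Icc 3 (M - 1),
          WeightedRR.quot (WeightedRR.numMid M k : QSeries) (WeightedRR.denMid M k)
      + ∑' j : ℕ, WeightedRR.tailTerm M (M + j)
      = WeightedRR.quot (WeightedRR.factor 1 M) (WeightedRR.factor WeightedRR.w M) *
          WeightedRR.quot 1
            (WeightedRR.factor WeightedRR.t 2 * WeightedRR.factor 1 3 *
              ∏' k : ℕ, WeightedRR.prodFactor k) ∧
    WeightedRR.HasNonnegCoeffs WeightedRR.num₁ ∧
    WeightedRR.HasNonnegCoeffs (WeightedRR.num₂ M) ∧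
    (∀ k ∈ Finset.Icc 3 (M - 1), WeightedRR.HasNonnegCoeffs (WeightedRR.numMid M k)) ∧
    (∀ k : ℕ, M ≤ k → WeightedRR.HasNonnegCoeffs (WeightedRR.numTail k)) := by
  open WeightedRR in
  exact ⟨summable_tailTerm M, multipliable_prodFactor, sum_side_eq_product_side hM,
    hasNonnegCoeffs_of_mem num₁_mem_natCoeffs, hasNonnegCoeffs_of_mem (num₂_mem_natCoeffs hM),
    fun k _ => hasNonnegCoeffs_of_mem
      (mul_mem (pow_mem q_mem_natCoeffs _) (qInt_mem_natCoeffs M)),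
    fun k _ => hasNonnegCoeffs_of_mem (pow_mem q_mem_natCoeffs _)⟩
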